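/- Let $k$ be an algebraically closed field of characteristic zero, let $n\ge 0$, and let $R=k[x_0,x_1,y_0,\ldots,y_n]$ be the $\mathbb N^2$-graded coordinate ring of $\mathbb P^1\times\mathbb P^n$ over $k$, with $\deg x_i=(1,0)$ and $\deg y_j=(0,1)$. For a finite non-empty set of points $X\subseteq\mathbb P^1\times\mathbb P^n$ let $I_X\subseteq R$ be the ideal generated by all bihomogeneous forms that vanish at every point of $X$. Call $X$ arithmetically Cohen-Macaulay (ACM) if $\dim R/I_X=\operatorname{depth} R/I_X=2$, where the depth is the supremum of the lengths of the $R/I_X$-regular sequences contained in the ideal $(x_0,x_1,y_0,\ldots,y_n)$. If $X$ is not ACM, then there are points $P_1\times Q_1$ and $P_2\times Q_2$ in $X$ with $P_1\neq P_2$ and $Q_1\neq Q_2$ such that $P_1\times Q_2\notin X$ and $P_2\times Q_1\notin X$. -/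

import Mathlib

open scoped LinearAlgebra.Projectivization

namespace Biprojective

/-- The set of closed points of `ℙⁿ × ℙᵐ` over the field `k`. -/
abbrev Point (k : Type*) [Field k] (n m : ℕ) : Type _ :=
  ℙ k (Fin (n + 1) → k) × ℙ k (Fin (m + 1) → k)

/-- The coordinate ring `k[x₀, …, xₙ, y₀, …, yₘ]` of `ℙⁿ × ℙᵐ`: the variable `xᵢ` is
`X (Sum.inl i)` and the variable `yⱼ` is `X (Sum.inr j)`. -/
abbrev CoordRing (k : Type*) [Field k] (n m : ℕ) : Type _ :=
  MvPolynomial (Fin (n + 1) ⊕ Fin (m + 1)) k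

/-- The bidegrees of the variables: `deg xᵢ = (1, 0)` and `deg yⱼ = (0, 1)`. -/
def varDegree (n m : ℕ) : Fin (n + 1) ⊕ Fin (m + 1) → ℕ × ℕ :=
  Sum.elim (fun _ => (1, 0)) (fun _ => (0, 1))

/-- `f` is a bihomogeneous form (of some bidegree in `ℕ²`). -/
def IsBihomogeneous {k : Type*} [Field k] {n m : ℕ} (f : CoordRing k n m) : Prop :=
  ∃ d : ℕ × ℕ, MvPolynomial.IsWeightedHomogeneous (varDegree n m) f d

/-- `f` vanishes at the point `p = P × Q`: it is zero at all homogeneous coordinates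
`([a₀ : ⋯ : aₙ], [b₀ : ⋯ : bₘ])` of `p`. -/
def VanishesAt {k : Type*} [Field k] {n m : ℕ} (f : CoordRing k n m) (p : Point k n m) : Prop :=
  ∀ (a : Fin (n + 1) → k) (b : Fin (m + 1) → k) (ha : a ≠ 0) (hb : b ≠ 0),
    Projectivization.mk k a ha = p.1 → Projectivization.mk k b hb = p.2 →
      MvPolynomial.eval (Sum.elim a b) f = 0

/-- The bihomogeneous ideal `I_X` of a set `X` of points of `ℙⁿ × ℙᵐ`: the ideal generated by
all bihomogeneous forms that vanish at every point of `X`. -/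
noncomputable def vanishingIdeal {k : Type*} [Field k] {n m : ℕ} (X : Set (Point k n m)) :
    Ideal (CoordRing k n m) :=
  Ideal.span {f | IsBihomogeneous f ∧ ∀ p ∈ X, VanishesAt f p}

/-- The graded maximal ideal `(x₀, …, xₙ, y₀, …, yₘ)` of the coordinate ring. -/
noncomputable def maxIdeal (k : Type*) [Field k] (n m : ℕ) : Ideal (CoordRing k n m) :=
  Ideal.span (Set.range MvPolynomial.X)

/-- The depth of an `R`-module `M` with respect to an ideal `J`: the supremum of the lengths of
the `M`-regular sequences of elements of `J`. -/
noncomputable def depth {R : Type*} [CommRing R] (J : Ideal R) (M : Type*) [AddCommGroup M]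
    [Module R M] : ℕ∞ :=
  ⨆ (rs : List R) (_ : (∀ r ∈ rs, r ∈ J) ∧ RingTheory.Sequence.IsRegular M rs), (rs.length : ℕ∞)

/-- A set `X` of points of `ℙⁿ × ℙᵐ` is arithmetically Cohen-Macaulay:
`dim R/I_X = depth R/I_X = 2`, where `2` is the number of projective factors and the depth
is taken with respect to the graded maximal ideal of `R`. -/
def IsACM {k : Type*} [Field k] {n m : ℕ} (X : Set (Point k n m)) : Prop :=
  ringKrullDim (CoordRing k n m ⧸ vanishingIdeal X) = 2 ∧
    depth (maxIdeal k n m) (CoordRing k n m ⧸ vanishingIdeal X) = 2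

end Biprojective

namespace Biprojective

open MvPolynomial

/-! ### Membership in `vanishingIdeal X` as vanishing on cones over points -/

section Vanishing

variable {k : Type*} [Field k] {n m : ℕ}

/-! By contraposition, assume the fibres of `X` over `ℙ¹` form a chain. Take linear forms `L` in the
`x`'s and `M` in the `y`'s that vanish at no point of `X`. Then `L` is a nonzerodivisor modulo
`I_X`. That `M` is one modulo `I_X + (L)` is the core (`mem_sup_of_linearFormSnd_mul_mem`), shown by
removing a largest fibre and inducting: over its base point lies every `Q` that occurs in `X`, so
relations can be tested there. Hence the depth is at least `2`. The dimension is at most `2`, since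
`I_X` contains a finite intersection of kernels of surjections onto `k[s, t]`, and the length of a
regular sequence is bounded by the dimension, so both equal `2`. -/

/-- Restriction of polynomials to the plane spanned by `(a, 0)` and `(0, b)`. -/
noncomputable def coneHom (a : Fin (n + 1) → k) (b : Fin (m + 1) → k) :
    CoordRing k n m →ₐ[k] MvPolynomial (Fin 2) k :=
  aeval (Sum.elim (fun i => C (a i) * X 0) (fun j => C (b j) * X 1))

lemma eval_coneHom (a : Fin (n + 1) → k) (b : Fin (m + 1) → k) (f : CoordRing k n m)
    (u : Fin 2 → k) :
    eval u (coneHom a b f) = eval (Sum.elim (u 0 • a) (u 1 • b)) f := by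
  induction f using MvPolynomial.induction_on with
  | C c => simp [coneHom]
  | add p q hp hq => simp [hp, hq]
  | mul_X p i hp =>
    rw [map_mul, map_mul, hp, map_mul]
    congr 1
    rcases i with i | i <;> simp [coneHom, mul_comm]

lemma coneHom_weightedHomogeneousComponent (a : Fin (n + 1) → k) (b : Fin (m + 1) → k)
    (d : ℕ × ℕ) (f : CoordRing k n m) :
    coneHom a b (weightedHomogeneousComponent (varDegree n m) d f) =
      weightedHomogeneousComponent ![((1, 0) : ℕ × ℕ), (0, 1)] d (coneHom a b f) := by
  induction f using MvPolynomial.induction_on' with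
  | add p q hp hq => simp [hp, hq]
  | monomial e c =>
    have h1 := isWeightedHomogeneous_monomial (varDegree n m) e c rfl
    have h2 : IsWeightedHomogeneous ![((1, 0) : ℕ × ℕ), (0, 1)] (coneHom a b (monomial e c))
        (Finsupp.weight (varDegree n m) e) := by
      rw [coneHom, aeval_monomial, Finsupp.weight_apply, Finsupp.prod, Finsupp.sum,
        ← zero_add (∑ i ∈ _, _)]
      refine (isWeightedHomogeneous_C _ c).mul (IsWeightedHomogeneous.prod _ _ _ fun i _ => ?_)
      refine IsWeightedHomogeneous.pow ?_ _
      rcases i with i | i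
      · simpa [varDegree] using (isWeightedHomogeneous_C ![((1, 0) : ℕ × ℕ), (0, 1)] (a i)).mul
          (isWeightedHomogeneous_X k ![((1, 0) : ℕ × ℕ), (0, 1)] 0)
      · simpa [varDegree] using (isWeightedHomogeneous_C ![((1, 0) : ℕ × ℕ), (0, 1)] (b i)).mul
          (isWeightedHomogeneous_X k ![((1, 0) : ℕ × ℕ), (0, 1)] 1)
    by_cases hd : d = Finsupp.weight (varDegree n m) e
    · subst hd
      rw [h1.weightedHomogeneousComponent_same, h2.weightedHomogeneousComponent_same]
    · rw [h1.weightedHomogeneousComponent_ne _ hd, h2.weightedHomogeneousComponent_ne _ hd,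
        map_zero]

lemma coneHom_surjective {a : Fin (n + 1) → k} {b : Fin (m + 1) → k} (ha : a ≠ 0) (hb : b ≠ 0) :
    Function.Surjective (coneHom a b) := by
  obtain ⟨i, hi⟩ := Function.ne_iff.mp ha
  obtain ⟨j, hj⟩ := Function.ne_iff.mp hb
  rw [← AlgHom.range_eq_top, eq_top_iff, ← MvPolynomial.adjoin_range_X, Algebra.adjoin_le_iff]
  rintro _ ⟨l, rfl⟩
  fin_cases l
  · refine ⟨C (a i)⁻¹ * X (Sum.inl i), ?_⟩
    simp only [Pi.zero_apply] at hi
    simp [coneHom, ← mul_assoc, ← C_mul, hi, algebraMap_eq]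
  · refine ⟨C (b j)⁻¹ * X (Sum.inr j), ?_⟩
    simp only [Pi.zero_apply] at hj
    simp [coneHom, ← mul_assoc, ← C_mul, hj, algebraMap_eq]

lemma coneHom_eq_zero_of_eval [Infinite k] {a : Fin (n + 1) → k} {b : Fin (m + 1) → k}
    {f : CoordRing k n m}
    (h : ∀ s t : k, s ≠ 0 → t ≠ 0 → eval (Sum.elim (s • a) (t • b)) f = 0) :
    coneHom a b f = 0 := by
  refine funext_set (fun _ => {0}ᶜ) (fun _ => (Set.finite_singleton 0).infinite_compl) ?_
  intro u hu
  rw [eval_coneHom, map_zero]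
  exact h _ _ (hu 0 trivial) (hu 1 trivial)

lemma vanishesAt_iff [Infinite k] {f : CoordRing k n m} {p : Point k n m} :
    VanishesAt f p ↔ coneHom p.1.rep p.2.rep f = 0 := by
  constructor
  · intro h
    refine coneHom_eq_zero_of_eval fun s t hs ht => ?_
    refine h _ _ (smul_ne_zero hs p.1.rep_nonzero) (smul_ne_zero ht p.2.rep_nonzero) ?_ ?_
    · conv_rhs => rw [← p.1.mk_rep]
      exact (Projectivization.mk_eq_mk_iff' k _ _ _ _).2 ⟨s, rfl⟩
    · conv_rhs => rw [← p.2.mk_rep]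
      exact (Projectivization.mk_eq_mk_iff' k _ _ _ _).2 ⟨t, rfl⟩
  · intro h a b ha hb hpa hpb
    rw [← p.1.mk_rep] at hpa
    rw [← p.2.mk_rep] at hpb
    obtain ⟨s, rfl⟩ := (Projectivization.mk_eq_mk_iff' k _ _ _ _).1 hpa
    obtain ⟨t, rfl⟩ := (Projectivization.mk_eq_mk_iff' k _ _ _ _).1 hpb
    simpa [h] using (eval_coneHom p.1.rep p.2.rep f ![s, t]).symm

/-- Restriction to a cone respects the bigrading, so every bihomogeneous component of such an `f`
vanishes on `X`. -/
lemma mem_vanishingIdeal_iff [Infinite k] {X : Set (Point k n m)} {f : CoordRing k n m} :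
    f ∈ vanishingIdeal X ↔ ∀ p ∈ X, coneHom p.1.rep p.2.rep f = 0 := by
  constructor
  · intro h p hp
    have : vanishingIdeal X ≤ RingHom.ker (coneHom p.1.rep p.2.rep) :=
      Ideal.span_le.2 fun g hg => vanishesAt_iff.1 (hg.2 p hp)
    exact this h
  · intro h
    rw [← sum_weightedHomogeneousComponent (varDegree n m) f,
      finsum_eq_sum _ (weightedHomogeneousComponent_finsupp f)]
    refine Ideal.sum_mem _ fun d _ => Ideal.subset_span ⟨⟨d,
      weightedHomogeneousComponent_isWeightedHomogeneous _ _⟩, fun p hp => ?_⟩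
    rw [vanishesAt_iff, coneHom_weightedHomogeneousComponent, h p hp, map_zero]

/-- The values `s = 0` and `t = 0` are allowed, although they give no point of the product; `s = 0`
is needed below. -/
lemma eval_eq_zero_of_mem_vanishingIdeal [Infinite k] {X : Set (Point k n m)}
    {f : CoordRing k n m} (hf : f ∈ vanishingIdeal X) {p : Point k n m} (hp : p ∈ X) (s t : k) :
    eval (Sum.elim (s • p.1.rep) (t • p.2.rep)) f = 0 := by
  simpa [mem_vanishingIdeal_iff.1 hf p hp] using (eval_coneHom p.1.rep p.2.rep f ![s, t]).symm

lemma mem_vanishingIdeal_of_eval [Infinite k] {X : Set (Point k n m)} {f : CoordRing k n m}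
    (h : ∀ p ∈ X, ∀ s t : k, s ≠ 0 → t ≠ 0 →
      eval (Sum.elim (s • p.1.rep) (t • p.2.rep)) f = 0) : f ∈ vanishingIdeal X :=
  mem_vanishingIdeal_iff.2 fun p hp => coneHom_eq_zero_of_eval (h p hp)

lemma mem_vanishingIdeal_of_mul_mem [Infinite k] {X : Set (Point k n m)} {g f : CoordRing k n m}
    (hg : ∀ p ∈ X, ∀ s t : k, s ≠ 0 → t ≠ 0 →
      eval (Sum.elim (s • p.1.rep) (t • p.2.rep)) g ≠ 0) (h : g * f ∈ vanishingIdeal X) :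
    f ∈ vanishingIdeal X := by
  refine mem_vanishingIdeal_of_eval fun p hp s t hs ht => ?_
  have := eval_eq_zero_of_mem_vanishingIdeal h hp s t
  rw [map_mul] at this
  exact (mul_eq_zero.1 this).resolve_left (hg p hp s t hs ht)

lemma exists_dotProduct_rep_ne_zero [Infinite k] {Y : Set (ℙ k (Fin (n + 1) → k))}
    (hY : Y.Finite) : ∃ c : Fin (n + 1) → k, ∀ P ∈ Y, c ⬝ᵥ P.rep ≠ 0 := by
  have := hY.to_subtype
  obtain ⟨φ, hφ⟩ := Module.exists_dual_forall_apply_ne_zero (K := k)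
    (fun P : Y => P.1.rep) fun P => P.1.rep_nonzero
  refine ⟨fun i => φ (Pi.single i 1), fun P hP => ?_⟩
  convert hφ ⟨P, hP⟩
  rw [φ.pi_apply_eq_sum_univ]
  refine Finset.sum_congr rfl fun i _ => ?_
  rw [smul_eq_mul, mul_comm]
  congr 1
  refine congrArg φ (_root_.funext fun j => ?_)
  simp [Pi.single_apply, eq_comm]

end Vanishing

/-! ### Linear forms and substitutions in the first set of variables -/

section LinearForms

variable {k : Type*} [Field k] {n m : ℕ}

/-- The linear form in the first set of variables with coefficients `c`. -/
noncomputable def linearFormFst (c : Fin (n + 1) → k) : CoordRing k n m :=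
  ∑ i, C (c i) * X (Sum.inl i)

/-- The linear form in the second set of variables with coefficients `d`. -/
noncomputable def linearFormSnd (d : Fin (m + 1) → k) : CoordRing k n m :=
  ∑ j, C (d j) * X (Sum.inr j)

lemma eval_linearFormFst (c a : Fin (n + 1) → k) (b : Fin (m + 1) → k) :
    eval (Sum.elim a b) (linearFormFst c) = c ⬝ᵥ a := by
  simp [linearFormFst, dotProduct]

lemma eval_linearFormSnd (d : Fin (m + 1) → k) (a : Fin (n + 1) → k) (b : Fin (m + 1) → k) :
    eval (Sum.elim a b) (linearFormSnd d) = d ⬝ᵥ b := by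
  simp [linearFormSnd, dotProduct]

lemma linearFormFst_mem_maxIdeal (c : Fin (n + 1) → k) :
    linearFormFst c ∈ maxIdeal k n m :=
  Ideal.sum_mem _ fun _ _ => Ideal.mul_mem_left _ _ (Ideal.subset_span ⟨_, rfl⟩)

lemma linearFormSnd_mem_maxIdeal (d : Fin (m + 1) → k) :
    linearFormSnd d ∈ maxIdeal k n m :=
  Ideal.sum_mem _ fun _ _ => Ideal.mul_mem_left _ _ (Ideal.subset_span ⟨_, rfl⟩)

/-- The substitution `xᵢ ↦ g i`, `yⱼ ↦ yⱼ`. -/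
noncomputable def substFst (g : Fin (n + 1) → CoordRing k n m) :
    CoordRing k n m →ₐ[k] CoordRing k n m :=
  aeval (Sum.elim g (fun j => X (Sum.inr j)))

lemma sub_substFst_mem {I : Ideal (CoordRing k n m)} {g : Fin (n + 1) → CoordRing k n m}
    (hg : ∀ i, X (Sum.inl i) - g i ∈ I) (f : CoordRing k n m) : f - substFst g f ∈ I := by
  have : (Ideal.Quotient.mkₐ k I) = (Ideal.Quotient.mkₐ k I).comp (substFst g) := by
    refine MvPolynomial.algHom_ext fun i => ?_
    rcases i with i | i
    · simpa [substFst] using Ideal.Quotient.eq.2 (hg i)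
    · simp [substFst]
  exact Ideal.Quotient.eq.1 (DFunLike.congr_fun this f)

lemma eval_substFst (g : Fin (n + 1) → CoordRing k n m) (f : CoordRing k n m)
    (a : Fin (n + 1) → k) (b : Fin (m + 1) → k) :
    eval (Sum.elim a b) (substFst g f) =
      eval (Sum.elim (fun i => eval (Sum.elim a b) (g i)) b) f := by
  induction f using MvPolynomial.induction_on with
  | C c => simp [substFst]
  | add p q hp hq => simp [hp, hq]
  | mul_X p i hp =>
    rw [map_mul, map_mul, hp, map_mul]
    congr 1
    rcases i with i | i <;> simp [substFst]

/-- The linear form on `ℙ¹` that vanishes at `a`. -/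
noncomputable def pointForm (a : Fin (1 + 1) → k) : CoordRing k 1 m :=
  C (a 1) * X (Sum.inl 0) - C (a 0) * X (Sum.inl 1)

lemma eval_pointForm (a c : Fin (1 + 1) → k) (b : Fin (m + 1) → k) :
    eval (Sum.elim c b) (pointForm a) = a 1 * c 0 - a 0 * c 1 := by
  simp [pointForm]

lemma eq_of_rep_proportional {P Q : ℙ k (Fin (1 + 1) → k)}
    (h : P.rep 1 * Q.rep 0 - P.rep 0 * Q.rep 1 = 0) : P = Q := by
  rw [← P.mk_rep, ← Q.mk_rep, Projectivization.mk_eq_mk_iff']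
  have hQ := Q.rep_nonzero
  by_cases h0 : Q.rep 0 = 0
  · have h1 : Q.rep 1 ≠ 0 := fun h1 => hQ (by ext i; fin_cases i <;> simp_all)
    have hp : P.rep 0 = 0 := by simp_all
    refine ⟨P.rep 1 / Q.rep 1, ?_⟩
    ext i
    fin_cases i <;> simp [h0, h1, hp]
  · refine ⟨P.rep 0 / Q.rep 0, ?_⟩
    ext i
    fin_cases i
    · simp [h0]
    · simp only [Fin.mk_one, Pi.smul_apply, smul_eq_mul]
      field_simp
      linear_combination -h

lemma linearFormFst_eq (c : Fin (1 + 1) → k) :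
    (linearFormFst c : CoordRing k 1 m) = C (c 0) * X (Sum.inl 0) + C (c 1) * X (Sum.inl 1) :=
  Fin.sum_univ_two _

/-- As `c ⬝ᵥ a ≠ 0`, the two forms span the linear forms on `ℙ¹`; modulo the form of `a`, each `xᵢ`
is a multiple of the other one. -/
lemma X_sub_mem_span_pointForm (a c : Fin (1 + 1) → k) (hc : c ⬝ᵥ a ≠ 0)
    (i : Fin (1 + 1)) :
    X (Sum.inl i) - C (a i / (c ⬝ᵥ a)) * linearFormFst c ∈
      (Ideal.span {pointForm a} : Ideal (CoordRing k 1 m)) := by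
  set e := c ⬝ᵥ a with he
  have he' : e = c 0 * a 0 + c 1 * a 1 := by simp [he, dotProduct, Fin.sum_univ_two]
  have hone : (C e⁻¹ : CoordRing k 1 m) * (C (c 0) * C (a 0) + C (c 1) * C (a 1)) = 1 := by
    rw [← C_mul, ← C_mul, ← C_add, ← he', ← C_mul, inv_mul_cancel₀ hc, C_1]
  rw [Ideal.mem_span_singleton]
  fin_cases i
  · refine ⟨C e⁻¹ * C (c 1), ?_⟩
    simp only [pointForm, linearFormFst_eq, div_eq_mul_inv, C_mul, Fin.zero_eta]
    linear_combination (-X (Sum.inl 0)) * hone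
  · refine ⟨-(C e⁻¹ * C (c 0)), ?_⟩
    simp only [pointForm, linearFormFst_eq, div_eq_mul_inv, C_mul, Fin.mk_one]
    linear_combination (-X (Sum.inl 1)) * hone

end LinearForms

/-! ### The second linear form is regular modulo the first -/

section Chain

variable {k : Type*} [Field k] {m : ℕ}

/-- The fibres of `X` over the first factor form a chain. -/
def FibresComparable {n : ℕ} (X : Set (Point k n m)) : Prop :=
  ∀ P₁ P₂ Q₁ Q₂, (P₁, Q₁) ∈ X → (P₂, Q₂) ∈ X → (P₁, Q₂) ∈ X ∨ (P₂, Q₁) ∈ X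

lemma FibresComparable.exists_largest {n : ℕ} {X : Set (Point k n m)} (hX : FibresComparable X)
    (hfin : X.Finite) (hne : X.Nonempty) :
    ∃ p ∈ X, ∀ q ∈ X, (p.1, q.2) ∈ X := by
  have hF : ∀ P, {Q | (P, Q) ∈ X}.Finite := fun P =>
    (hfin.image Prod.snd).subset fun Q hQ => ⟨(P, Q), hQ, rfl⟩
  -- In a chain of finite sets, one of maximal cardinality contains all others.
  obtain ⟨p, hp, hmax⟩ := Set.exists_max_image X (fun p => {Q | (p.1, Q) ∈ X}.ncard) hfin hne
  refine ⟨p, hp, fun q hq => ?_⟩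
  by_contra hcon
  have hsub : {Q | (p.1, Q) ∈ X} ⊆ {Q | (q.1, Q) ∈ X} := fun Q hQ =>
    (hX p.1 q.1 Q q.2 hQ hq).resolve_left hcon
  have := Set.eq_of_subset_of_ncard_le hsub (hmax q hq) (hF _)
  exact hcon (this.symm.subset (show q.2 ∈ {Q | (q.1, Q) ∈ X} from hq))

theorem mem_sup_of_linearFormSnd_mul_mem [Infinite k] {X : Set (Point k 1 m)} (hfin : X.Finite)
    (hX : FibresComparable X) {c : Fin (1 + 1) → k} {d : Fin (m + 1) → k}
    (hc : ∀ p ∈ X, c ⬝ᵥ p.1.rep ≠ 0) (hd : ∀ p ∈ X, d ⬝ᵥ p.2.rep ≠ 0) {f : CoordRing k 1 m}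
    (hf : linearFormSnd d * f ∈ vanishingIdeal X ⊔ Ideal.span {linearFormFst c}) :
    f ∈ vanishingIdeal X ⊔ Ideal.span {linearFormFst c} := by
  induction hN : X.ncard using Nat.strong_induction_on generalizing X f with
  | _ N ih =>
  subst hN
  rcases X.eq_empty_or_nonempty with rfl | hne
  · exact Ideal.mem_sup_left (mem_vanishingIdeal_iff.2 (by simp))
  obtain ⟨p₁, hp₁, hlarge⟩ := hX.exists_largest hfin hne
  set L : CoordRing k 1 m := linearFormFst c with hL
  set M : CoordRing k 1 m := linearFormSnd d with hM
  set a := p₁.1.rep with ha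
  set l : CoordRing k 1 m := pointForm a with hl
  have hca : c ⬝ᵥ a ≠ 0 := hc p₁ hp₁
  have hsubst := X_sub_mem_span_pointForm (m := m) a c hca
  set X' : Set (Point k 1 m) := {p ∈ X | p.1 ≠ p₁.1} with hX'
  have hX'X : X' ⊆ X := Set.sep_subset _ _
  have hlX' : ∀ p ∈ X', ∀ s t : k, s ≠ 0 → t ≠ 0 →
      eval (Sum.elim (s • p.1.rep) (t • p.2.rep)) l ≠ 0 := by
    intro p hp s t hs _ h
    rw [hl, eval_pointForm] at h
    refine hp.2 (eq_of_rep_proportional ?_).symm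
    refine (mul_eq_zero.1 (?_ : s * _ = 0)).resolve_left hs
    simp only [Pi.smul_apply, smul_eq_mul] at h
    linear_combination h
  have hlX : ∀ {g}, g ∈ vanishingIdeal X' → l * g ∈ vanishingIdeal X := by
    intro g hg
    refine mem_vanishingIdeal_of_eval fun p hp s t hs ht => ?_
    by_cases hpp : p.1 = p₁.1
    · rw [map_mul, hl, eval_pointForm, hpp]
      simp only [Pi.smul_apply, smul_eq_mul, ← ha]
      ring
    · rw [map_mul, eval_eq_zero_of_mem_vanishingIdeal hg (p := p) ⟨hp, hpp⟩, mul_zero]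
  -- the part of `f` that does not involve the first set of variables lies in the ideal
  have hf₀ : substFst (fun _ => 0) f ∈ vanishingIdeal X := by
    obtain ⟨g, hg, w, hw, hgw⟩ := Submodule.mem_sup.1 hf
    obtain ⟨h, rfl⟩ := Ideal.mem_span_singleton.1 hw
    refine mem_vanishingIdeal_of_eval fun p hp s t hs ht => ?_
    rw [eval_substFst]
    -- At `x = 0` both `g` and `L` vanish, while `M` does not.
    have h1 := eval_eq_zero_of_mem_vanishingIdeal hg (hlarge p hp) 0 t
    have h2 := congrArg (eval (Sum.elim ((0 : k) • a) (t • p.2.rep))) hgw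
    rw [map_add, map_mul, map_mul, h1, hL, hM, eval_linearFormFst, eval_linearFormSnd] at h2
    simp only [zero_smul, dotProduct_zero, zero_mul, zero_add, dotProduct_smul, smul_eq_mul] at h2
    have h3 := (mul_eq_zero.1 h2.symm).resolve_left (mul_ne_zero ht (hd p hp))
    convert h3 using 4
    ext i
    simp
  have hsub : f - substFst (fun _ => 0) f ∈ Ideal.span {l} ⊔ Ideal.span {L} := by
    refine sub_substFst_mem (fun i => ?_) f
    rw [sub_zero, ← sub_add_cancel (MvPolynomial.X (Sum.inl i)) (C (a i / (c ⬝ᵥ a)) * L)]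
    exact Ideal.add_mem _ (Ideal.mem_sup_left (hsubst i))
      (Ideal.mem_sup_right (Ideal.mul_mem_left _ _ (Ideal.mem_span_singleton_self L)))
  obtain ⟨lb, hlb, Le, hLe, hlw⟩ := Submodule.mem_sup.1 hsub
  obtain ⟨b, rfl⟩ := Ideal.mem_span_singleton.1 hlb
  obtain ⟨e, rfl⟩ := Ideal.mem_span_singleton.1 hLe
  have hMlb : M * (l * b) ∈ vanishingIdeal X ⊔ Ideal.span {L} := by
    have h1 : M * (l * b) = M * f - M * substFst (fun _ => 0) f - M * e * L := by
      linear_combination M * hlw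
    rw [h1]
    exact Ideal.sub_mem _ (Ideal.sub_mem _ hf (Ideal.mem_sup_left (Ideal.mul_mem_left _ _ hf₀)))
      (Ideal.mem_sup_right (Ideal.mul_mem_left _ _ (Ideal.mem_span_singleton_self L)))
  obtain ⟨g, hg, Lh, hLh, hgh⟩ := Submodule.mem_sup.1 hMlb
  obtain ⟨h, rfl⟩ := Ideal.mem_span_singleton.1 hLh
  -- modulo the form of the point `p₁.1`, the cofactor `h` lies in the ideal
  set h' := substFst (fun i => C (a i / (c ⬝ᵥ a)) * L) h with hh'
  obtain ⟨v, hv⟩ := Ideal.mem_span_singleton.1 (sub_substFst_mem hsubst h)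
  have hh'X : h' ∈ vanishingIdeal X := by
    refine mem_vanishingIdeal_of_eval fun p hp s t hs ht => ?_
    -- With this `r`, the substitution defining `h'` sends the `x`-coordinates `s • p.1.rep` to `r •
    -- a`. There `l` and `g` vanish and `L` does not, so `h` vanishes.
    set r := s * (c ⬝ᵥ p.1.rep) / (c ⬝ᵥ a) with hr
    have hr0 : r ≠ 0 := div_ne_zero (mul_ne_zero hs (hc p hp)) hca
    have h1 := congrArg (eval (Sum.elim (r • a) (t • p.2.rep))) hgh
    rw [map_add, map_mul, map_mul, map_mul,
      eval_eq_zero_of_mem_vanishingIdeal hg (hlarge p hp) r t, hL, hl, eval_linearFormFst,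
      eval_pointForm] at h1
    have h2 : r * (c ⬝ᵥ a) * eval (Sum.elim (r • a) (t • p.2.rep)) h = 0 := by
      simp only [dotProduct_smul, Pi.smul_apply, smul_eq_mul] at h1
      linear_combination h1
    have h3 := (mul_eq_zero.1 h2).resolve_left (mul_ne_zero hr0 hca)
    rw [hh', eval_substFst]
    convert h3 using 4
    ext i
    simp only [map_mul, eval_C, hL, eval_linearFormFst, dotProduct_smul, Pi.smul_apply,
      smul_eq_mul, hr]
    ring
  -- Cancel `l`, which has no zero on `X'`.
  have hdiff : M * b - L * v ∈ vanishingIdeal X' := by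
    refine mem_vanishingIdeal_of_mul_mem hlX' ?_
    have h1 : l * (M * b - L * v) = g + L * h' := by linear_combination -hgh + L * hv
    rw [h1]
    have h2 : g + L * h' ∈ vanishingIdeal X := Ideal.add_mem _ hg (Ideal.mul_mem_left _ _ hh'X)
    exact mem_vanishingIdeal_iff.2 fun p hp => mem_vanishingIdeal_iff.1 h2 p (hX'X hp)
  have hMb : M * b ∈ vanishingIdeal X' ⊔ Ideal.span {L} := by
    rw [← sub_add_cancel (M * b) (L * v)]
    exact Ideal.add_mem _ (Ideal.mem_sup_left hdiff)
      (Ideal.mem_sup_right (Ideal.mul_mem_right _ _ (Ideal.mem_span_singleton_self L)))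
  have hcard : X'.ncard < X.ncard :=
    Set.ncard_lt_ncard ⟨hX'X, fun hsub => (hsub hp₁).2 rfl⟩ hfin
  have hX'chain : FibresComparable X' := fun P₁ P₂ Q₁ Q₂ h₁ h₂ =>
    (hX P₁ P₂ Q₁ Q₂ h₁.1 h₂.1).imp (fun h => ⟨h, h₁.2⟩) (fun h => ⟨h, h₂.2⟩)
  have hb := ih _ hcard (hfin.subset hX'X) hX'chain (fun p hp => hc p hp.1)
    (fun p hp => hd p hp.1) hMb rfl
  obtain ⟨e', he', Lw, hLw, hbe⟩ := Submodule.mem_sup.1 hb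
  obtain ⟨w, rfl⟩ := Ideal.mem_span_singleton.1 hLw
  have hfin : f = (substFst (fun _ => 0) f + l * e') + L * (l * w + e) := by
    linear_combination -hlw - l * hbe
  rw [hfin]
  exact Ideal.add_mem _ (Ideal.mem_sup_left (Ideal.add_mem _ hf₀ (hlX he')))
    (Ideal.mem_sup_right (Ideal.mul_mem_right _ _ (Ideal.mem_span_singleton_self L)))

end Chain

/-! ### Dimension, depth and the Cohen-Macaulay property -/

section Dimension

open RingTheory.Sequence

lemma supportDim_add_length_le {R : Type*} [CommRing R] [IsNoetherianRing R] {M : Type*}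
    [AddCommGroup M] [Module R M] [Module.Finite R M] (rs : List R) (hrs : IsRegular M rs) :
    Module.supportDim R (M ⧸ Ideal.ofList rs • (⊤ : Submodule R M)) + rs.length ≤
      Module.supportDim R M := by
  induction rs generalizing M with
  | nil =>
    rw [Ideal.ofList_nil, Submodule.bot_smul]
    simpa using (Module.supportDim_eq_of_equiv (Submodule.quotEquivOfEqBot ⊥ rfl)).le
  | cons x rs ih =>
    obtain ⟨hx, hrs⟩ := (isRegular_cons_iff M _ _).mp hrs
    rw [Module.supportDim_eq_of_equiv
      (Submodule.quotOfListConsSMulTopEquivQuotSMulTopInner M x _), List.length_cons,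
      Nat.cast_succ, ← add_assoc]
    exact (add_le_add_left (ih hrs) 1).trans
      (Module.supportDim_quotSMulTop_succ_le_of_notMem_minimalPrimes
        fun _ => hx.notMem_of_mem_minimalPrimes)

lemma length_le_supportDim {R : Type*} [CommRing R] [IsNoetherianRing R] {M : Type*}
    [AddCommGroup M] [Module R M] [Module.Finite R M] (rs : List R) (hrs : IsRegular M rs) :
    (rs.length : WithBot ℕ∞) ≤ Module.supportDim R M := by
  have : Nontrivial (M ⧸ Ideal.ofList rs • (⊤ : Submodule R M)) :=
    Submodule.Quotient.nontrivial_iff.2 hrs.top_ne_smul.symm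
  have : Nonempty (Module.support R (M ⧸ Ideal.ofList rs • (⊤ : Submodule R M))) :=
    Module.nonempty_support_of_nontrivial.to_subtype
  exact (le_add_of_nonneg_left Order.krullDim_nonneg).trans (supportDim_add_length_le rs hrs)

lemma depth_le_of_ringKrullDim_quotient_le {R : Type*} [CommRing R] [IsNoetherianRing R]
    (J I : Ideal R) {N : ℕ} (hN : ringKrullDim (R ⧸ I) ≤ N) : depth J (R ⧸ I) ≤ N := by
  refine iSup₂_le fun rs hrs => ?_
  have h := (length_le_supportDim rs hrs.2).trans
    ((Module.supportDim_quotient_eq_ringKrullDim I).le.trans hN)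
  exact_mod_cast h

variable {k : Type*} [Field k] {n m : ℕ}

lemma ringKrullDim_quotient_vanishingIdeal_le [Infinite k] {X : Set (Point k n m)}
    (hfin : X.Finite) : ringKrullDim (CoordRing k n m ⧸ vanishingIdeal X) ≤ 2 := by
  have hker : hfin.toFinset.inf (fun p => RingHom.ker (coneHom p.1.rep p.2.rep)) ≤
      vanishingIdeal X := by
    intro f hf
    rw [mem_vanishingIdeal_iff]
    intro p hp
    exact Finset.inf_le (f := fun p : Point k n m => RingHom.ker (coneHom p.1.rep p.2.rep))
      (hfin.mem_toFinset.2 hp) hf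
  rw [ringKrullDim_quotient]
  refine iSup_le fun q => ?_
  -- The smallest prime of the chain contains one of the kernels, hence so does the whole chain.
  obtain ⟨p, -, hp⟩ := (Ideal.IsPrime.inf_le' (q.head.1.2)).1 (hker.trans q.head.2)
  have hdim : ringKrullDim (CoordRing k n m ⧸ RingHom.ker (coneHom p.1.rep p.2.rep)) = 2 := by
    rw [ringKrullDim_eq_of_ringEquiv (Ideal.quotientKerAlgEquivOfSurjective
      (coneHom_surjective p.1.rep_nonzero p.2.rep_nonzero)).toRingEquiv,
      MvPolynomial.ringKrullDim_of_isNoetherianRing]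
    simp
  rw [← hdim, ringKrullDim_quotient]
  let q' : LTSeries (PrimeSpectrum.zeroLocus
      (RingHom.ker (coneHom p.1.rep p.2.rep) : Set (CoordRing k n m))) :=
    ⟨q.length, fun i => ⟨(q i).1, hp.trans (q.head_le i)⟩, fun i => q.step i⟩
  exact Order.LTSeries.length_le_krullDim q'

lemma isRegular_linearForms [Infinite k] {X : Set (Point k 1 m)} (hfin : X.Finite)
    (hne : X.Nonempty) (hX : FibresComparable X) {c : Fin (1 + 1) → k} {d : Fin (m + 1) → k}
    (hc : ∀ p ∈ X, c ⬝ᵥ p.1.rep ≠ 0) (hd : ∀ p ∈ X, d ⬝ᵥ p.2.rep ≠ 0) :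
    IsRegular (CoordRing k 1 m ⧸ vanishingIdeal X)
      [(linearFormFst c : CoordRing k 1 m), linearFormSnd d] := by
  have hQ : ∀ (N : Submodule (CoordRing k 1 m) (CoordRing k 1 m ⧸ vanishingIdeal X)) r,
      (∀ f, Ideal.Quotient.mk _ (r * f) ∈ N → Ideal.Quotient.mk _ f ∈ N) →
      IsSMulRegular ((CoordRing k 1 m ⧸ vanishingIdeal X) ⧸ N) r := by
    intro N r h
    rw [isSMulRegular_quotient_iff_mem_of_smul_mem]
    intro x hx
    obtain ⟨f, rfl⟩ := Ideal.Quotient.mk_surjective x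
    exact h f hx
  refine ⟨⟨fun i hi => ?_⟩, fun htop => ?_⟩
  · match i, hi with
    | 0, _ =>
      refine hQ _ _ fun f hf => ?_
      simp only [List.take_zero, Ideal.ofList_nil, Submodule.bot_smul, Submodule.mem_bot,
        Ideal.Quotient.eq_zero_iff_mem, List.getElem_cons_zero] at hf ⊢
      refine mem_vanishingIdeal_of_mul_mem (fun p hp s t hs _ => ?_) hf
      rw [eval_linearFormFst, dotProduct_smul]
      exact mul_ne_zero hs (hc p hp)
    | 1, _ =>
      have key : ∀ f : CoordRing k 1 m, Ideal.Quotient.mk (vanishingIdeal X) f ∈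
          (Ideal.ofList [(linearFormFst c : CoordRing k 1 m)] •
            (⊤ : Submodule (CoordRing k 1 m) (CoordRing k 1 m ⧸ vanishingIdeal X))) ↔
          f ∈ vanishingIdeal X ⊔ Ideal.span {linearFormFst c} := by
        intro f
        rw [Ideal.ofList_singleton, Submodule.ideal_span_singleton_smul,
          Submodule.mem_smul_pointwise_iff_exists]
        constructor
        · rintro ⟨x, -, hx⟩
          obtain ⟨g, rfl⟩ := Ideal.Quotient.mk_surjective x
          have h1 := Ideal.Quotient.eq.1
            (show Ideal.Quotient.mk (vanishingIdeal X) (linearFormFst c * g) =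
              Ideal.Quotient.mk _ f from hx)
          rw [← sub_sub_cancel (linearFormFst c * g) f]
          exact Ideal.sub_mem _ (Ideal.mem_sup_right (Ideal.mul_mem_right _ _
            (Ideal.mem_span_singleton_self _))) (Ideal.mem_sup_left h1)
        · intro hf
          obtain ⟨g, hg, w, hw, rfl⟩ := Submodule.mem_sup.1 hf
          obtain ⟨h, rfl⟩ := Ideal.mem_span_singleton.1 hw
          refine ⟨Ideal.Quotient.mk _ h, trivial, ?_⟩
          rw [map_add, Ideal.Quotient.eq_zero_iff_mem.2 hg, zero_add]
          rfl
      refine hQ _ _ fun f hf => (key f).2 ?_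
      exact mem_sup_of_linearFormSnd_mul_mem hfin hX hc hd ((key _).1 hf)
  · obtain ⟨p, hp⟩ := hne
    -- Evaluation at the origin kills both forms but not `1`; it descends to the quotient because
    -- `X` is non-empty.
    let ε : (CoordRing k 1 m ⧸ vanishingIdeal X) →+* k :=
      Ideal.Quotient.lift _ (eval 0) fun f hf => by
        convert eval_eq_zero_of_mem_vanishingIdeal hf hp 0 0 using 3
        ext i
        rcases i with i | i <;> simp
    have hε : ∀ x ∈ Ideal.ofList [(linearFormFst c : CoordRing k 1 m), linearFormSnd d] •
        (⊤ : Submodule (CoordRing k 1 m) (CoordRing k 1 m ⧸ vanishingIdeal X)), ε x = 0 := by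
      intro x hx
      refine Submodule.smul_induction_on hx (fun r hr y _ => ?_)
        (fun x y hx hy => by rw [map_add, hx, hy, add_zero])
      · have hr0 : eval 0 r = 0 := by
          suffices Ideal.ofList [(linearFormFst c : CoordRing k 1 m), linearFormSnd d] ≤
              RingHom.ker (eval 0) from this hr
          rw [Ideal.ofList, Ideal.span_le]
          intro r hr
          simp only [List.mem_cons, List.not_mem_nil, or_false, Set.mem_ofPred_eq] at hr
          rcases hr with rfl | rfl <;> simp [linearFormFst, linearFormSnd]
        obtain ⟨g, rfl⟩ := Ideal.Quotient.mk_surjective y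
        change eval 0 (r * g) = 0
        rw [map_mul, hr0, zero_mul]
    have h1 := hε 1 (htop ▸ trivial)
    rw [map_one] at h1
    exact one_ne_zero h1

theorem isACM_of_fibresComparable [Infinite k] {X : Set (Point k 1 m)} (hfin : X.Finite)
    (hne : X.Nonempty) (hX : FibresComparable X) : IsACM X := by
  obtain ⟨c, hc⟩ := exists_dotProduct_rep_ne_zero (hfin.image Prod.fst)
  obtain ⟨d, hd⟩ := exists_dotProduct_rep_ne_zero (hfin.image Prod.snd)
  have hreg := isRegular_linearForms hfin hne hX (fun p hp => hc p.1 ⟨p, hp, rfl⟩)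
    (fun p hp => hd p.2 ⟨p, hp, rfl⟩)
  have hle := ringKrullDim_quotient_vanishingIdeal_le hfin
  have hdepth : 2 ≤ depth (maxIdeal k 1 m) (CoordRing k 1 m ⧸ vanishingIdeal X) := by
    refine le_iSup₂_of_le _ ⟨?_, hreg⟩ (by simp)
    simp only [List.mem_cons, List.not_mem_nil, or_false]
    rintro r (rfl | rfl)
    · exact linearFormFst_mem_maxIdeal c
    · exact linearFormSnd_mem_maxIdeal d
  refine ⟨le_antisymm hle ?_, le_antisymm ?_ hdepth⟩
  · rw [← Module.supportDim_quotient_eq_ringKrullDim]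
    exact length_le_supportDim _ hreg
  · exact depth_le_of_ringKrullDim_quotient_le _ _ (N := 2) hle

end Dimension

end Biprojective

theorem corollary4p8 {k : Type*} [Field k] [IsAlgClosed k] [CharZero k] (n : ℕ)
    (X : Set (Biprojective.Point k 1 n)) (hfin : X.Finite) (hne : X.Nonempty)
    (hX : ¬ Biprojective.IsACM X) :
    ∃ (P₁ P₂ : ℙ k (Fin (1 + 1) → k)) (Q₁ Q₂ : ℙ k (Fin (n + 1) → k)),
      (P₁, Q₁) ∈ X ∧ (P₂, Q₂) ∈ X ∧ P₁ ≠ P₂ ∧ Q₁ ≠ Q₂ ∧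
        (P₁, Q₂) ∉ X ∧ (P₂, Q₁) ∉ X := by
  by_contra hcon
  push Not at hcon
  refine hX (Biprojective.isACM_of_fibresComparable hfin hne fun P₁ P₂ Q₁ Q₂ h₁ h₂ => ?_)
  by_contra! h
  refine h.2 (hcon P₁ P₂ Q₁ Q₂ h₁ h₂ ?_ ?_ h.1)
  · rintro rfl
    exact h.1 h₂
  · rintro rfl
    exact h.1 h₁
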